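/- Let $\alpha\in\mathbb{C}$ with $\Re(\alpha)>0$. For $w,z\in\mathbb{C}$ with $w\notin\{-1,-2,-3,\dots\}$ put $$\binom{w}{z}=\frac{\Gamma(w+1)}{\Gamma(z+1)\,\Gamma(w-z+1)},$$ where $1/\Gamma$ is understood as the entire reciprocal gamma function (so it is $0$ at the poles of $\Gamma$), and let $\operatorname{sech}(z)=1/\cosh(z)$. Then the function $x\mapsto\binom{i\alpha}{x}\operatorname{sech}\left(\frac{\pi x}{\alpha}\right)$ is Lebesgue integrable on $\mathbb{R}$, and $$\int_{-\infty}^{\infty}\binom{i\alpha}{x}\operatorname{sech}\left(\frac{\pi x}{\alpha}\right)dx=\frac{\alpha\,2^{i\alpha}}{\sqrt{\pi}}\cdot\frac{\Gamma\left(\frac{i\alpha}{2}+\frac12\right)}{\Gamma\left(\frac{i\alpha}{2}+1\right)},$$ where $2^{i\alpha}=e^{i\alpha\log 2}$. -/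

import Mathlib

/-- The binomial coefficient with two complex arguments,
`Γ(w+1) / (Γ(z+1) Γ(w-z+1))`, for `w` not a negative integer. The factors `1/Γ` are the entire
reciprocal gamma function: `Complex.Gamma` takes the value `0` at its poles, so that the quotient
is `0` when `z+1` or `w-z+1` is a pole of `Γ`, as it should be. -/
noncomputable def complexBinom (w z : ℂ) : ℂ :=
  Complex.Gamma (w + 1) / (Complex.Gamma (z + 1) * Complex.Gamma (w - z + 1))

/-- The hyperbolic secant `1 / cosh z`. -/
noncomputable def complexSech (z : ℂ) : ℂ :=
  1 / Complex.cosh z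

open Complex Filter Topology MeasureTheory Set

/-! With `w = iα`, the integrand is `-P(z) / sin(π(z - w/2)/w)`, where `P = complexBinom w` is
entire and invariant under `z ↦ w - z`. This reflection swaps the two edges of the strip `0 ≤ Im z ≤
Im w` and negates the sine, so a contour integral around the strip is twice the wanted integral, and
only the pole at `w/2` contributes. No residue theorem is used: a multiple of `1 / sin(π(z - w/2)/(i
Im w))` has the same pole and the same antisymmetry, and its integral is that of a translated,
rescaled real `sech`. The difference is holomorphic and integrates to zero
(`integral_eq_zero_of_antisymm`). Polynomial growth of `P` against exponential decay of `1/sin`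
controls the ends. The value `P(w/2)` comes from Legendre duplication. -/

/-! ### Growth of the binomial in a strip -/

theorem complexBinom_symm (w z : ℂ) : complexBinom w (w - z) = complexBinom w z := by
  unfold complexBinom
  rw [mul_comm, sub_sub_cancel]

theorem complexBinom_eq_mul_inv (w z : ℂ) :
    complexBinom w z = Gamma (w + 1) * ((Gamma (z + 1))⁻¹ * (Gamma (w - z + 1))⁻¹) := by
  rw [complexBinom, div_eq_mul_inv, mul_inv]

theorem differentiable_complexBinom (w : ℂ) : Differentiable ℂ (complexBinom w) := by
  have h1 : Differentiable ℂ fun z : ℂ => (Gamma (z + 1))⁻¹ :=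
    differentiable_one_div_Gamma.comp (differentiable_id.add_const 1)
  have h2 : Differentiable ℂ fun z : ℂ => (Gamma (w - z + 1))⁻¹ :=
    differentiable_one_div_Gamma.comp ((differentiable_id.const_sub w).add_const 1)
  rw [funext (complexBinom_eq_mul_inv w)]
  exact (h1.mul h2).const_mul _

theorem complexBinom_add_one (w : ℂ) {z : ℂ} (hz : z + 1 ≠ 0) :
    complexBinom w (z + 1) = complexBinom w z * ((w - z) / (z + 1)) := by
  have h1 := one_div_Gamma_eq_self_mul_one_div_Gamma_add_one (z + 1)
  have h2 := one_div_Gamma_eq_self_mul_one_div_Gamma_add_one (w - z)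
  rw [complexBinom_eq_mul_inv, complexBinom_eq_mul_inv, h1,
    show w - (z + 1) + 1 = w - z by ring, h2]
  field_simp

/-- Compactness bounds the part with `0 ≤ Re z ≤ 1`. Each shift by 1 then costs at most `1 + M/(n+1)
≤ (1 + 1/(n+1))^M` (Bernoulli), and these factors telescope. -/
theorem exists_norm_complexBinom_le_of_nonneg (w : ℂ) (h : ℝ) :
    ∃ (C : ℝ) (M : ℕ), 0 ≤ C ∧ ∀ z : ℂ, 0 ≤ z.re → 0 ≤ z.im → z.im ≤ h →
      ‖complexBinom w z‖ ≤ C * (1 + z.re) ^ M := by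
  obtain ⟨C, hC⟩ := ((isCompact_Icc (a := (0 : ℝ)) (b := 1)).reProdIm
    (isCompact_Icc (a := (0 : ℝ)) (b := h))).exists_bound_of_continuousOn
    (differentiable_complexBinom w).continuous.continuousOn
  obtain ⟨M, hM⟩ := exists_nat_ge (‖w‖ + 1 + |h|)
  have hC' : ∀ ζ : ℂ, 0 ≤ ζ.re → ζ.re ≤ 1 → 0 ≤ ζ.im → ζ.im ≤ h →
      ‖complexBinom w ζ‖ ≤ |C| := fun ζ h1 h2 h3 h4 =>
    (hC ζ (mem_reProdIm.2 ⟨⟨h1, h2⟩, ⟨h3, h4⟩⟩)).trans (le_abs_self C)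
  have key : ∀ ζ : ℂ, 0 ≤ ζ.re → ζ.re ≤ 1 → 0 ≤ ζ.im → ζ.im ≤ h → ∀ n : ℕ,
      ‖complexBinom w (ζ + n)‖ ≤ |C| * (n + 1 : ℝ) ^ M := by
    intro ζ h1 h2 h3 h4 n
    induction n with
    | zero => simpa using hC' ζ h1 h2 h3 h4
    | succ n ih =>
      have hn : (0 : ℝ) < n + 1 := by positivity
      have hre : (n + 1 : ℝ) ≤ (ζ + n + 1).re := by simp; linarith
      have hden : (n + 1 : ℝ) ≤ ‖ζ + n + 1‖ := hre.trans (re_le_norm _)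
      have hne : ζ + n + 1 ≠ 0 := norm_pos_iff.1 (hn.trans_le hden)
      have hζ : ‖ζ‖ ≤ 1 + |h| := by
        refine (norm_le_abs_re_add_abs_im ζ).trans (add_le_add ?_ ?_)
        · rwa [abs_of_nonneg h1]
        · exact abs_le_abs_of_nonneg h3 h4
      have hnum : ‖w - (ζ + n)‖ ≤ (n + 1 : ℝ) + M := by
        refine (norm_sub_le _ _).trans ?_
        have := norm_add_le ζ (n : ℂ)
        rw [norm_natCast] at this
        linarith
      have hq : ‖(w - (ζ + n)) / (ζ + n + 1)‖ ≤ (1 + 1 / (n + 1 : ℝ)) ^ M := by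
        rw [norm_div]
        calc ‖w - (ζ + n)‖ / ‖ζ + n + 1‖ ≤ ((n + 1 : ℝ) + M) / (n + 1) := by gcongr
          _ = 1 + M * (1 / (n + 1 : ℝ)) := by field_simp
          _ ≤ _ := one_add_mul_le_pow (by have : 0 ≤ 1 / (n + 1 : ℝ) := by positivity
                                          linarith) M
      rw [Nat.cast_succ, ← add_assoc, complexBinom_add_one w hne, norm_mul]
      calc _ ≤ (|C| * (n + 1 : ℝ) ^ M) * (1 + 1 / (n + 1 : ℝ)) ^ M := by gcongr
        _ = |C| * ((n + 1 : ℝ) * (1 + 1 / (n + 1 : ℝ))) ^ M := by rw [mul_pow, mul_assoc]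
        _ = _ := by
          congr 2
          push_cast
          field_simp
  refine ⟨|C|, M, abs_nonneg C, fun z h1 h2 h3 => ?_⟩
  have hfl := Nat.floor_le h1
  have hlt := (Nat.lt_floor_add_one z.re).le
  have := key (z - (⌊z.re⌋₊ : ℂ)) (by simpa using hfl) (by simp; linarith)
    (by simpa using h2) (by simpa using h3) ⌊z.re⌋₊
  rw [sub_add_cancel] at this
  refine this.trans ?_
  rw [add_comm 1 z.re]
  gcongr

/-- The reflection `z ↦ w - z` preserves the strip and carries its left end to the right one; `‖w‖ ≤
|Re z|` ensures `Re (w - z) ≥ 0` there. -/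
theorem exists_norm_complexBinom_le (w : ℂ) :
    ∃ (C : ℝ) (M : ℕ), 0 ≤ C ∧ ∀ z : ℂ, ‖w‖ ≤ |z.re| → 0 ≤ z.im → z.im ≤ w.im →
      ‖complexBinom w z‖ ≤ C * (1 + ‖w‖ + |z.re|) ^ M := by
  obtain ⟨C, M, hC, hb⟩ := exists_norm_complexBinom_le_of_nonneg w w.im
  refine ⟨C, M, hC, fun z h1 h2 h3 => ?_⟩
  have hw := abs_le.1 (abs_re_le_norm w)
  rcases le_total 0 z.re with h0 | h0
  · refine (hb z h0 h2 h3).trans ?_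
    rw [abs_of_nonneg h0]
    gcongr
    linarith [norm_nonneg w]
  · rw [abs_of_nonpos h0] at h1 ⊢
    have hre : 0 ≤ (w - z).re := by rw [sub_re]; linarith
    rw [← complexBinom_symm]
    refine (hb (w - z) hre (by simpa using h3) (by simpa using h2)).trans ?_
    rw [sub_re] at *
    gcongr ?_ * ?_ ^ M
    linarith

/-! ### Exponential decay of `1/sin` along the strip -/

theorem norm_sin_ge (s : ℂ) : (Real.exp |s.im| - 1) / 2 ≤ ‖Complex.sin s‖ := by
  have e1 : ‖cexp (-s * I)‖ = Real.exp s.im := by simp [norm_exp]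
  have e2 : ‖cexp (s * I)‖ = Real.exp (-s.im) := by simp [norm_exp]
  have e : ‖Complex.sin s‖ = ‖cexp (-s * I) - cexp (s * I)‖ / 2 := by
    simp [Complex.sin]
  rw [e]
  gcongr
  rcases le_total 0 s.im with h | h
  · have := norm_sub_norm_le (cexp (-s * I)) (cexp (s * I))
    have h1 : Real.exp (-s.im) ≤ 1 := Real.exp_le_one_iff.2 (by linarith)
    rw [e1, e2] at this
    rw [abs_of_nonneg h]
    linarith
  · have := norm_sub_norm_le (cexp (s * I)) (cexp (-s * I))
    have h1 : Real.exp s.im ≤ 1 := Real.exp_le_one_iff.2 h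
    rw [e1, e2, norm_sub_rev] at this
    rw [abs_of_nonpos h]
    linarith

theorem exists_le_abs_im_pi_mul_div {v : ℂ} (hv : 0 < v.im) (b : ℂ) :
    ∃ δ > 0, ∃ K : ℝ, 0 ≤ K ∧ ∀ z : ℂ, |z.im| ≤ v.im →
      δ * |z.re| - K ≤ |((Real.pi : ℂ) * (z - b) / v).im| := by
  have hn : 0 < normSq v := normSq_pos.2 (fun h => by simp [h] at hv)
  have hpi := Real.pi_pos
  refine ⟨Real.pi * v.im / normSq v, by positivity,
    Real.pi / normSq v * (v.im * |v.re|) + |((Real.pi : ℂ) * b / v).im|, by positivity,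
    fun z hz => ?_⟩
  have e : ((Real.pi : ℂ) * (z - b) / v).im =
      Real.pi / normSq v * (z.im * v.re - z.re * v.im) - ((Real.pi : ℂ) * b / v).im := by
    rw [mul_sub, sub_div, sub_im]
    congr 1
    rw [div_im]
    simp
    ring
  rw [e]
  have h1 := abs_sub_abs_le_abs_sub (Real.pi / normSq v * (z.im * v.re - z.re * v.im))
    ((Real.pi : ℂ) * b / v).im
  have h2 : Real.pi / normSq v * (v.im * |z.re| - v.im * |v.re|) ≤
      |Real.pi / normSq v * (z.im * v.re - z.re * v.im)| := by
    rw [abs_mul, abs_of_pos (by positivity : 0 < Real.pi / normSq v)]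
    gcongr
    have h3 := abs_sub_abs_le_abs_sub (z.re * v.im) (z.im * v.re)
    rw [abs_mul, abs_mul, abs_of_pos hv, abs_sub_comm] at h3
    have : |z.im| * |v.re| ≤ v.im * |v.re| := by gcongr
    linarith
  have h4 : Real.pi * v.im / normSq v * |z.re| = Real.pi / normSq v * (v.im * |z.re|) := by ring
  rw [mul_sub] at h2
  linarith

theorem exists_norm_div_sin_le {v : ℂ} (hv : 0 < v.im) (b : ℂ) {P : ℂ → ℂ} {C a : ℝ} {M : ℕ}
    (hC : 0 ≤ C) (ha : 0 ≤ a)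
    (hP : ∀ z : ℂ, a ≤ |z.re| → 0 ≤ z.im → z.im ≤ v.im → ‖P z‖ ≤ C * (1 + a + |z.re|) ^ M) :
    ∃ ε > 0, ∃ K X : ℝ, ∀ z : ℂ, X ≤ |z.re| → 0 ≤ z.im → z.im ≤ v.im →
      ‖P z / Complex.sin ((Real.pi : ℂ) * (z - b) / v)‖ ≤ K * Real.exp (-ε * |z.re|) := by
  obtain ⟨δ, hδ, K, hK, hb⟩ := exists_le_abs_im_pi_mul_div hv b
  -- Half of the decay rate `δ` is spent on absorbing the polynomial. The threshold `(K + 1) / δ`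
  -- makes the exponential at least 2, so that `(e - 1)/2 ≥ e/4`.
  refine ⟨δ / 2, by positivity,
    C * (M.factorial * (2 / δ) ^ M * Real.exp (δ / 2 * (1 + a))) * (4 * Real.exp K),
    max a ((K + 1) / δ), fun z hX h0 h1 => ?_⟩
  have hza : a ≤ |z.re| := (le_max_left _ _).trans hX
  have hzK : (K + 1) / δ ≤ |z.re| := (le_max_right _ _).trans hX
  rw [div_le_iff₀ hδ, mul_comm] at hzK
  have him := hb z (by rwa [abs_of_nonneg h0])
  set s := (Real.pi : ℂ) * (z - b) / v with hs
  have hs1 := norm_sin_ge s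
  have hexp : Real.exp (δ * |z.re| - K) ≤ Real.exp |s.im| := Real.exp_le_exp.2 him
  have h2 : 2 ≤ Real.exp (δ * |z.re| - K) := by
    linarith [Real.add_one_le_exp (δ * |z.re| - K)]
  have hsin : Real.exp (δ * |z.re| - K) / 4 ≤ ‖Complex.sin s‖ := by linarith
  have hinv : ‖Complex.sin s‖⁻¹ ≤ 4 * Real.exp K * Real.exp (-(δ * |z.re|)) := by
    refine (inv_anti₀ (by positivity) hsin).trans (le_of_eq ?_)
    rw [inv_div, Real.exp_sub, Real.exp_neg]
    field_simp
  have hpow : (1 + a + |z.re|) ^ M ≤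
      M.factorial * (2 / δ) ^ M * Real.exp (δ / 2 * (1 + a)) * Real.exp (δ / 2 * |z.re|) := by
    have := Real.pow_div_factorial_le_exp (δ / 2 * (1 + a + |z.re|)) (by positivity) M
    rw [div_le_iff₀ (by positivity), mul_pow] at this
    rw [mul_assoc _ (Real.exp _), ← Real.exp_add, ← mul_add]
    have e : (2 / δ) ^ M * (δ / 2) ^ M = 1 := by
      rw [← mul_pow, div_mul_div_cancel₀ hδ.ne', div_self two_ne_zero, one_pow]
    calc (1 + a + |z.re|) ^ M = (2 / δ) ^ M * ((δ / 2) ^ M * (1 + a + |z.re|) ^ M) := by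
          rw [← mul_assoc, e, one_mul]
      _ ≤ (2 / δ) ^ M * (Real.exp (δ / 2 * (1 + a + |z.re|)) * M.factorial) := by gcongr
      _ = _ := by ring
  rw [norm_div, div_eq_mul_inv]
  calc ‖P z‖ * ‖Complex.sin s‖⁻¹ ≤ (C * (M.factorial * (2 / δ) ^ M * Real.exp (δ / 2 * (1 + a)) *
        Real.exp (δ / 2 * |z.re|))) * (4 * Real.exp K * Real.exp (-(δ * |z.re|))) := by
        gcongr
        exact (hP z hza h0 h1).trans (by gcongr)
    _ = C * (M.factorial * (2 / δ) ^ M * Real.exp (δ / 2 * (1 + a))) * (4 * Real.exp K) *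
        (Real.exp (δ / 2 * |z.re|) * Real.exp (-(δ * |z.re|))) := by ring
    _ = _ := by
        rw [← Real.exp_add]
        congr 2
        ring

theorem sin_pi_mul_div_ne_zero {v u : ℂ} (hv : 0 < v.im) (hu : |u.im| < v.im) (hu0 : u ≠ 0) :
    Complex.sin ((Real.pi : ℂ) * u / v) ≠ 0 := by
  intro h
  obtain ⟨k, hk⟩ := Complex.sin_eq_zero_iff.1 h
  have hv0 : v ≠ 0 := fun h => by simp [h] at hv
  have hpi : (Real.pi : ℂ) ≠ 0 := by exact_mod_cast Real.pi_ne_zero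
  have e : u = k * v := by
    rw [div_eq_iff hv0] at hk
    exact mul_left_cancel₀ hpi (by rw [hk]; ring)
  have e2 : u.im = k * v.im := by simp [e]
  rw [e2, abs_mul, abs_of_pos hv, mul_lt_iff_lt_one_left hv] at hu
  have : |k| < 1 := by exact_mod_cast hu
  rw [Int.abs_lt_one_iff] at this
  simp [this] at e
  exact hu0 e

theorem integrable_of_continuous_of_norm_le_exp_neg_abs {E : Type*} [NormedAddCommGroup E]
    {F : ℝ → E} (hF : Continuous F)
    {ε K X : ℝ} (hε : 0 < ε) (hb : ∀ x : ℝ, X ≤ |x| → ‖F x‖ ≤ K * Real.exp (-ε * |x|)) :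
    Integrable F := by
  refine hF.locallyIntegrable.integrable_of_isBigO_atBot_atTop
    (g := fun x : ℝ => Real.exp (ε * x)) (g' := fun x : ℝ => Real.exp (-ε * x)) ?_ ?_ ?_ ?_
  · refine Asymptotics.IsBigO.of_bound K ?_
    filter_upwards [eventually_le_atBot (-X), eventually_le_atBot 0] with x h1 h2
    have := hb x (by rw [abs_of_nonpos h2]; linarith)
    rwa [abs_of_nonpos h2, neg_mul_neg, ← Real.norm_of_nonneg (Real.exp_pos (ε * x)).le] at this
  · exact ⟨Iic 0, Iic_mem_atBot 0, integrableOn_exp_mul_Iic hε 0⟩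
  · refine Asymptotics.IsBigO.of_bound K ?_
    filter_upwards [eventually_ge_atTop X, eventually_ge_atTop 0] with x h1 h2
    have := hb x (by rwa [abs_of_nonneg h2])
    rwa [abs_of_nonneg h2, ← Real.norm_of_nonneg (Real.exp_pos (-ε * x)).le] at this
  · exact ⟨Ioi 0, Ioi_mem_atTop 0, exp_neg_integrableOn_Ioi 0 hε⟩

/-! ### Contour argument and the comparison integral -/

theorem integral_one_div_cosh : ∫ x : ℝ, 1 / Real.cosh x = Real.pi := by
  have hcosh : ∀ x : ℝ, Real.exp |x| / 2 ≤ Real.cosh x := fun x => by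
    rw [← Real.cosh_abs, Real.cosh_eq]
    linarith [Real.exp_pos (-|x|)]
  have hint : Integrable fun x : ℝ => 1 / Real.cosh x := by
    refine integrable_of_continuous_of_norm_le_exp_neg_abs (ε := 1) (K := 2) (X := 0)
      (continuous_const.div Real.continuous_cosh fun x => (Real.cosh_pos x).ne') one_pos
      fun x _ => ?_
    rw [Real.norm_of_nonneg (by have := Real.cosh_pos x; positivity), one_div]
    refine (inv_anti₀ (by positivity) (hcosh x)).trans (le_of_eq ?_)
    rw [inv_div, neg_one_mul, Real.exp_neg, div_eq_mul_inv]
  have hderiv : ∀ x : ℝ,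
      HasDerivAt (fun x => 2 * Real.arctan (Real.exp x)) (1 / Real.cosh x) x := fun x => by
    refine (((Real.hasDerivAt_exp x).arctan).const_mul 2).congr_deriv ?_
    rw [Real.cosh_eq, Real.exp_neg]
    have := Real.exp_pos x
    field_simp
    ring
  have hbot : Tendsto (fun x => 2 * Real.arctan (Real.exp x)) atBot (𝓝 0) := by
    have := ((Real.continuous_arctan.tendsto 0).comp Real.tendsto_exp_atBot).const_mul 2
    simpa using this
  have htop : Tendsto (fun x => 2 * Real.arctan (Real.exp x)) atTop (𝓝 Real.pi) := by
    have := ((Real.tendsto_arctan_atTop.mono_right nhdsWithin_le_nhds).comp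
      Real.tendsto_exp_atTop).const_mul 2
    rwa [mul_div_cancel₀ _ two_ne_zero] at this
  rw [integral_of_hasDerivAt_of_tendsto hderiv hint hbot htop, sub_zero]

/-- By antisymmetry the upper edge contributes the same as the lower one, so Cauchy's theorem on
growing rectangles gives twice the integral equal to zero. -/
theorem integral_eq_zero_of_antisymm {w : ℂ} (hw : 0 < w.im) {G : ℂ → ℂ}
    (hG : DifferentiableOn ℂ G {z : ℂ | 0 ≤ z.im ∧ z.im ≤ w.im})
    (hs : ∀ x : ℝ, G (w - x) = -G x) (hi : Integrable fun x : ℝ => G x)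
    {b : ℝ → ℝ} (hb : Tendsto b atTop (𝓝 0))
    (hd : ∀ᶠ R in atTop, ∀ z : ℂ, |z.re| = R → 0 ≤ z.im → z.im ≤ w.im → ‖G z‖ ≤ b R) :
    ∫ x : ℝ, G x = 0 := by
  have top : ∀ x : ℝ, G (x + w.im * I) = -G ((w.re - x : ℝ) : ℂ) := by
    intro x
    rw [← hs]
    congr 1
    apply Complex.ext <;> simp
  have hit : Integrable fun x : ℝ => G (x + w.im * I) := by
    simp_rw [top]
    exact (hi.comp_sub_left w.re).neg
  have htop : ∫ x : ℝ, G (x + w.im * I) = -∫ x : ℝ, G x := by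
    simp_rw [top, integral_neg]
    rw [integral_sub_left_eq_self (fun x : ℝ => G x)]
  have l1 := intervalIntegral_tendsto_integral hi tendsto_neg_atTop_atBot tendsto_id
  have l2 := intervalIntegral_tendsto_integral hit tendsto_neg_atTop_atBot tendsto_id
  have side : ∀ c : ℝ → ℝ, (∀ᶠ R in atTop, |c R| = R) →
      Tendsto (fun R : ℝ => I • ∫ y : ℝ in (0 : ℝ)..w.im, G (c R + y * I)) atTop (𝓝 0) := by
    intro c hc
    refine squeeze_zero_norm' (a := fun R => b R * w.im) ?_ (by simpa using hb.mul_const w.im)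
    filter_upwards [hc, hd] with R h1 h2
    rw [norm_smul, norm_I, one_mul]
    have := intervalIntegral.norm_integral_le_of_norm_le_const (a := 0) (b := w.im)
      (f := fun y : ℝ => G (c R + y * I)) (C := b R) (fun y hy => ?_)
    · simpa [abs_of_pos hw] using this
    · rw [uIoc_of_le hw.le] at hy
      exact h2 _ (by simpa using h1) (by simpa using hy.1.le) (by simpa using hy.2)
  have s1 := side id (by filter_upwards [eventually_ge_atTop 0] with R hR using abs_of_nonneg hR)
  have s2 := side (fun R => -R)
    (by filter_upwards [eventually_ge_atTop 0] with R hR using by rw [abs_neg, abs_of_nonneg hR])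
  have lim := ((l1.sub l2).add s1).sub s2
  have z0 : ∀ R : ℝ, ((∫ x : ℝ in -R..id R, G x) - ∫ x : ℝ in -R..id R, G (x + w.im * I)) +
      (I • ∫ y : ℝ in (0 : ℝ)..w.im, G (id R + y * I)) -
      (I • ∫ y : ℝ in (0 : ℝ)..w.im, G ((-R : ℝ) + y * I)) = 0 := by
    intro R
    have := integral_boundary_rect_eq_zero_of_differentiableOn G (-R : ℝ) (R + w.im * I) (hG.mono ?_)
    · simpa using this
    · rintro z ⟨-, hz⟩
      simp [uIcc_of_le hw.le] at hz
      exact hz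
  simp only [id] at lim z0
  simp_rw [z0] at lim
  have e := tendsto_nhds_unique lim tendsto_const_nhds
  rw [htop] at e
  linear_combination e / 2

theorem integral_one_div_sin_of_im {w : ℂ} (hw : 0 < w.im) :
    ∫ x : ℝ, 1 / Complex.sin ((Real.pi : ℂ) * (x - w / 2) / (w.im * I)) = -w.im := by
  have hne : (w.im : ℂ) ≠ 0 := by exact_mod_cast hw.ne'
  have e : ∀ x : ℝ, 1 / Complex.sin ((Real.pi : ℂ) * (x - w / 2) / (w.im * I)) =
      ((-(1 / Real.cosh ((x - w.re / 2) / (w.im / Real.pi))) : ℝ) : ℂ) := fun x => by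
    have harg : (Real.pi : ℂ) * (x - w / 2) / (w.im * I) =
        -((((x - w.re / 2) / (w.im / Real.pi) : ℝ) : ℂ) * I) - Real.pi / 2 := by
      have hpi : (Real.pi : ℂ) ≠ 0 := by exact_mod_cast Real.pi_ne_zero
      have hI : (I : ℂ) ^ 2 = -1 := I_sq
      conv_lhs => rw [← re_add_im w]
      push_cast
      simp only [add_im, mul_im, ofReal_im, ofReal_re, I_im, I_re, mul_one, mul_zero, add_zero,
        zero_add]
      field_simp
      linear_combination (x * 2 - w.re : ℂ) * hI
    rw [harg, Complex.sin_sub_pi_div_two, Complex.cos_neg, Complex.cos_mul_I]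
    push_cast
    rw [one_div_neg_eq_neg_one_div]
  simp_rw [e]
  rw [integral_complex_ofReal, integral_neg,
    integral_sub_right_eq_self (fun x : ℝ => 1 / Real.cosh (x / (w.im / Real.pi))) (w.re / 2),
    Measure.integral_comp_div (fun x : ℝ => 1 / Real.cosh x), integral_one_div_cosh,
    abs_of_pos (by have := Real.pi_pos; positivity), smul_eq_mul, div_mul_cancel₀ _ Real.pi_ne_zero]
  push_cast
  rfl

/-! ### Cancelling the pole -/

theorem exists_differentiableOn_sin_factor {v : ℂ} (hv : 0 < v.im) (c : ℂ) :
    ∃ D : ℂ → ℂ, Differentiable ℂ D ∧ D c = Real.pi / v ∧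
      (∀ z, |(z - c).im| < v.im → D z ≠ 0) ∧
      ∀ z, Complex.sin ((Real.pi : ℂ) * (z - c) / v) = (z - c) * D z := by
  have hv0 : v ≠ 0 := fun h => by simp [h] at hv
  have hd : ∀ z : ℂ, HasDerivAt (fun z => Complex.sin ((Real.pi : ℂ) * (z - c) / v))
      (Complex.cos ((Real.pi : ℂ) * (z - c) / v) * (Real.pi / v)) z := fun z => by
    have := ((((hasDerivAt_id z).sub_const c).const_mul (Real.pi : ℂ)).div_const v).csin
    simpa using this
  have hfac : ∀ z, Complex.sin ((Real.pi : ℂ) * (z - c) / v) = (z - c) *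
      dslope (fun z => Complex.sin ((Real.pi : ℂ) * (z - c) / v)) c z := fun z => by
    have := sub_smul_dslope (fun z => Complex.sin ((Real.pi : ℂ) * (z - c) / v)) c z
    simpa using this.symm
  have hc : dslope (fun z => Complex.sin ((Real.pi : ℂ) * (z - c) / v)) c c = Real.pi / v := by
    rw [dslope_same, (hd c).deriv]
    simp
  refine ⟨_, ?_, hc, fun z hz h0 => ?_, hfac⟩
  · rw [← differentiableOn_univ, Complex.differentiableOn_dslope univ_mem, differentiableOn_univ]
    exact fun z => (hd z).differentiableAt
  · rcases eq_or_ne z c with rfl | hzc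
    · rw [hc] at h0
      exact div_ne_zero (by exact_mod_cast Real.pi_ne_zero) hv0 h0
    · refine sin_pi_mul_div_ne_zero hv hz (sub_ne_zero.2 hzc) ?_
      rw [hfac, h0, mul_zero]

theorem exists_differentiableOn_eq_sub_of_sin {w : ℂ} (hw : 0 < w.im) {P : ℂ → ℂ}
    (hP : Differentiable ℂ P) :
    ∃ G : ℂ → ℂ, DifferentiableOn ℂ G {z : ℂ | 0 ≤ z.im ∧ z.im ≤ w.im} ∧
      ∀ z, z ≠ w / 2 → G z = P z / Complex.sin ((Real.pi : ℂ) * (z - w / 2) / w) -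
        P (w / 2) * w / (w.im * I) *
          (1 / Complex.sin ((Real.pi : ℂ) * (z - w / 2) / (w.im * I))) := by
  have hv : 0 < ((w.im : ℂ) * I).im := by simpa using hw
  obtain ⟨D₁, d₁, c₁, n₁, s₁⟩ := exists_differentiableOn_sin_factor hw (w / 2)
  obtain ⟨D₂, d₂, c₂, n₂, s₂⟩ := exists_differentiableOn_sin_factor hv (w / 2)
  have hpi : (Real.pi : ℂ) ≠ 0 := by exact_mod_cast Real.pi_ne_zero
  have hw0 : w ≠ 0 := fun h => by simp [h] at hw
  have hne : (w.im : ℂ) ≠ 0 := by exact_mod_cast hw.ne'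
  have him : (w / 2).im = w.im / 2 := by simp
  have hstrip : ∀ z : ℂ, 0 ≤ z.im → z.im ≤ w.im → |(z - w / 2).im| < w.im := fun z h0 h1 => by
    rw [sub_im, him, abs_lt]
    constructor <;> linarith
  -- `κ` equates the residues: `D₁` and `D₂` take the values `π/w` and `π/(i Im w)` at `w/2`, so `H`
  -- vanishes there and its divided difference is the required `G`.
  set κ := P (w / 2) * w / (w.im * I) with hκ
  set H : ℂ → ℂ := fun z => P z / D₁ z - κ / D₂ z with hH
  have hHd : DifferentiableOn ℂ H {z : ℂ | 0 ≤ z.im ∧ z.im ≤ w.im} := fun z hz =>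
    (((hP z).div (d₁ z) (n₁ z (hstrip z hz.1 hz.2))).sub
      ((differentiableAt_const κ).div (d₂ z)
        (n₂ z (by simpa using hstrip z hz.1 hz.2)))).differentiableWithinAt
  have hH0 : H (w / 2) = 0 := by
    simp only [hH, c₁, c₂, hκ]
    field_simp
    ring
  have hnhds : {z : ℂ | 0 ≤ z.im ∧ z.im ≤ w.im} ∈ 𝓝 (w / 2) := by
    have : Complex.im ⁻¹' (Icc 0 w.im) ∈ 𝓝 (w / 2) :=
      continuous_im.continuousAt.preimage_mem_nhds
        (Icc_mem_nhds (by rw [him]; linarith) (by rw [him]; linarith))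
    exact this
  refine ⟨dslope H (w / 2), (Complex.differentiableOn_dslope hnhds).2 hHd, fun z hz => ?_⟩
  rw [dslope_of_ne _ hz, slope_def_field, hH0, s₁, s₂, sub_zero, sub_div, mul_one_div,
    div_div, div_div, mul_comm (D₁ z), mul_comm (D₂ z)]

theorem integral_div_sin_of_symm {w : ℂ} (hw : 0 < w.im) {P : ℂ → ℂ} (hP : Differentiable ℂ P)
    (hs : ∀ z, P (w - z) = P z) {C : ℝ} {M : ℕ} (hC : 0 ≤ C)
    (hb : ∀ z : ℂ, ‖w‖ ≤ |z.re| → 0 ≤ z.im → z.im ≤ w.im →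
      ‖P z‖ ≤ C * (1 + ‖w‖ + |z.re|) ^ M) :
    Integrable (fun x : ℝ => P x / Complex.sin ((Real.pi : ℂ) * (x - w / 2) / w)) ∧
      ∫ x : ℝ, P x / Complex.sin ((Real.pi : ℂ) * (x - w / 2) / w) = I * w * P (w / 2) := by
  have hv : 0 < ((w.im : ℂ) * I).im := by simpa using hw
  have hw0 : w ≠ 0 := fun h => by simp [h] at hw
  have hne : (w.im : ℂ) ≠ 0 := by exact_mod_cast hw.ne'
  have him : (w / 2).im = w.im / 2 := by simp
  obtain ⟨ε₁, hε₁, K₁, X₁, b₁⟩ := exists_norm_div_sin_le hw (w / 2) hC (norm_nonneg w) hb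
  obtain ⟨ε₂, hε₂, K₂, X₂, b₂⟩ := exists_norm_div_sin_le hv (w / 2) (P := fun _ => 1)
    (C := 1) (a := 0) (M := 0) zero_le_one le_rfl (fun z _ _ _ => by simp)
  obtain ⟨G, hG, hGe⟩ := exists_differentiableOn_eq_sub_of_sin hw hP
  have hreal : ∀ x : ℝ, (x : ℂ) ≠ w / 2 := fun x h => by
    have := congrArg Complex.im h
    rw [him, ofReal_im] at this
    linarith
  have hsin : ∀ v : ℂ, v.im = w.im → ∀ x : ℝ,
      Complex.sin ((Real.pi : ℂ) * (x - w / 2) / v) ≠ 0 := fun v hvw x =>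
    sin_pi_mul_div_ne_zero (by rwa [hvw])
      (by rw [sub_im, him, hvw, ofReal_im, zero_sub, abs_neg, abs_of_pos (by linarith)]; linarith)
      (sub_ne_zero.2 (hreal x))
  have hcs : ∀ v : ℂ, Continuous fun x : ℝ =>
      Complex.sin ((Real.pi : ℂ) * (x - w / 2) / v) := fun v => by fun_prop
  have i₁ : Integrable fun x : ℝ => P x / Complex.sin ((Real.pi : ℂ) * (x - w / 2) / w) :=
    integrable_of_continuous_of_norm_le_exp_neg_abs
      ((hP.continuous.comp continuous_ofReal).div (hcs w) (hsin w rfl)) hε₁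
      fun x hx => b₁ x (by simpa using hx) (by simp) (by simpa using hw.le)
  have i₂ : Integrable fun x : ℝ =>
      1 / Complex.sin ((Real.pi : ℂ) * (x - w / 2) / (w.im * I)) :=
    integrable_of_continuous_of_norm_le_exp_neg_abs
      (continuous_const.div (hcs _) (hsin _ (by simp))) hε₂
      fun x hx => b₂ x (by simpa using hx) (by simp) (by simpa using hw.le)
  refine ⟨i₁, ?_⟩
  set κ := P (w / 2) * w / (w.im * I) with hκ
  have hGr := fun x : ℝ => hGe x (hreal x)
  have hneg : ∀ v : ℂ, ∀ z : ℂ, Complex.sin ((Real.pi : ℂ) * (w - z - w / 2) / v) =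
      -Complex.sin ((Real.pi : ℂ) * (z - w / 2) / v) := fun v z => by
    rw [← Complex.sin_neg]
    congr 1
    ring
  have hexp : ∀ ε > 0, ∀ K : ℝ, Tendsto (fun R : ℝ => K * Real.exp (-ε * R)) atTop (𝓝 0) :=
    fun ε hε K => by
      have := (Real.tendsto_exp_atBot.comp
        (tendsto_id.const_mul_atTop_of_neg (neg_lt_zero.2 hε))).const_mul K
      simpa using this
  have hG0 : ∫ x : ℝ, G x = 0 := by
    refine integral_eq_zero_of_antisymm hw hG (fun x => ?_) ?_
      (b := fun R => K₁ * Real.exp (-ε₁ * R) + ‖κ‖ * (K₂ * Real.exp (-ε₂ * R))) ?_ ?_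
    · rw [hGe _ (fun h => hreal x (by linear_combination -h)), hGr, hneg, hneg, hs, div_neg,
        div_neg]
      ring
    · simp_rw [hGr]
      exact i₁.sub (i₂.const_mul κ)
    · simpa using (hexp ε₁ hε₁ K₁).add ((hexp ε₂ hε₂ K₂).const_mul ‖κ‖)
    · filter_upwards [eventually_ge_atTop X₁, eventually_ge_atTop X₂,
        eventually_gt_atTop |(w / 2).re|] with R h1 h2 h3 z hz h0 him
      rw [hGe z (fun h => by rw [h] at hz; exact h3.ne hz)]
      refine (norm_sub_le _ _).trans ?_
      rw [norm_mul, ← hz]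
      gcongr
      · exact b₁ z (by rwa [hz]) h0 him
      · exact b₂ z (by rwa [hz]) h0 (by simpa using him)
  simp_rw [hGr] at hG0
  rw [integral_sub i₁ (i₂.const_mul κ), integral_const_mul, integral_one_div_sin_of_im hw] at hG0
  rw [sub_eq_zero.1 hG0, hκ]
  field_simp
  rw [I_sq]
  ring

/-! ### The central value and the conclusion -/

theorem complexBinom_half {w : ℂ} (hw : 0 < w.im) :
    complexBinom w (w / 2) = (2 : ℂ) ^ w / ((Real.sqrt Real.pi : ℝ) : ℂ) *
      (Gamma (w / 2 + 1 / 2) / Gamma (w / 2 + 1)) := by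
  have hΓ : Gamma (w / 2 + 1) ≠ 0 := Gamma_ne_zero fun m h => by
    have := congrArg Complex.im h
    simp at this
    exact hw.ne' this
  have hpi : ((Real.sqrt Real.pi : ℝ) : ℂ) ≠ 0 := by
    exact_mod_cast (Real.sqrt_pos.2 Real.pi_pos).ne'
  -- Duplication at `w/2 + 1/2` turns `Γ(w + 1)` into a product and cancels one of the two factors
  -- `Γ(w/2 + 1)`.
  have h := Complex.Gamma_mul_Gamma_add_half (w / 2 + 1 / 2)
  rw [show w / 2 + 1 / 2 + 1 / 2 = w / 2 + 1 by ring,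
    show 2 * (w / 2 + 1 / 2) = w + 1 by ring, show 1 - (w + 1) = -w by ring, cpow_neg] at h
  have h2 : (2 : ℂ) ^ w ≠ 0 := by simp [cpow_eq_zero_iff]
  rw [complexBinom, show w - w / 2 = w / 2 by ring]
  generalize Gamma (w / 2 + 1) = A at h hΓ ⊢
  generalize Gamma (w / 2 + 1 / 2) = B at h ⊢
  field_simp at h ⊢
  linear_combination -h

theorem mainTheorem11 (α : ℂ) (hα : 0 < α.re) :
    MeasureTheory.Integrable
        (fun x : ℝ => complexBinom (Complex.I * α) (x : ℂ) *
          complexSech ((Real.pi : ℂ) * (x : ℂ) / α)) MeasureTheory.volume ∧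
      ∫ x : ℝ, complexBinom (Complex.I * α) (x : ℂ) *
          complexSech ((Real.pi : ℂ) * (x : ℂ) / α) =
        α * (2 : ℂ) ^ (Complex.I * α) / ((Real.sqrt Real.pi : ℝ) : ℂ) *
          (Complex.Gamma (Complex.I * α / 2 + 1 / 2) /
            Complex.Gamma (Complex.I * α / 2 + 1)) := by
  have hw : 0 < (I * α).im := by simpa using hα
  have hα0 : α ≠ 0 := fun h => by simp [h] at hα
  obtain ⟨C, M, hC, hb⟩ := exists_norm_complexBinom_le (I * α)
  obtain ⟨h1, h2⟩ := integral_div_sin_of_symm hw (differentiable_complexBinom (I * α))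
    (complexBinom_symm (I * α)) hC hb
  have e : (fun x : ℝ => complexBinom (I * α) (x : ℂ) *
      complexSech ((Real.pi : ℂ) * (x : ℂ) / α)) = fun x : ℝ => -(complexBinom (I * α) x /
        Complex.sin ((Real.pi : ℂ) * (x - I * α / 2) / (I * α))) := by
    funext x
    have harg : (Real.pi : ℂ) * (x - I * α / 2) / (I * α) =
        -((Real.pi : ℂ) * x / α * I) - Real.pi / 2 := by
      have hI : (I : ℂ) ^ 2 = -1 := I_sq
      field_simp
      linear_combination 2 * x * hI
    rw [harg, Complex.sin_sub_pi_div_two, Complex.cos_neg, Complex.cos_mul_I, complexSech,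
      mul_one_div, div_neg, neg_neg]
  rw [e]
  refine ⟨h1.neg, ?_⟩
  rw [integral_neg, h2, complexBinom_half hw]
  have hI : (I : ℂ) * I = -1 := I_mul_I
  linear_combination (-(α * ((2 : ℂ) ^ (I * α) / ((Real.sqrt Real.pi : ℝ) : ℂ) *
    (Gamma (I * α / 2 + 1 / 2) / Gamma (I * α / 2 + 1))))) * hI
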